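/- Let $f$ be a complex-valued harmonic mapping in the unit disk $\mathbb{D}=\{z\in\mathbb{C}:|z|<1\}$ that is locally univalent (every point of $\mathbb{D}$ has a neighbourhood on which $f$ is injective), and suppose that its dilatation $\omega=\overline{f_{\overline z}}/f_z$ maps $\mathbb{D}$ into $\mathbb{D}$. Let $J_f=|f_z|^2-|f_{\overline z}|^2$ be the Jacobian of $f$, let $$P_f=(\log J_f)_z,\qquad S_f=(P_f)_z-\tfrac12 (P_f)^2$$ be its pre-Schwarzian and Schwarzian derivatives, and put $$\omega^*(z)=\frac{(1-|z|^2)\,\omega'(z)}{1-|\omega(z)|^2},\qquad A_f(z)=\tfrac12(1-|z|^2)P_f(z)-\overline z,\qquad z\in\mathbb{D}.$$ If $$(1-|z|^2)^2|S_f(z)|+2|\omega^*(z)A_f(z)|\le\tfrac12|\omega^*(z)|^2\qquad\text{for all } z\in\mathbb{D},$$ then $f$ is injective in $\mathbb{D}$. -/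

import Mathlib

noncomputable section

namespace PlanarHarmonic

/-- The complex-linear Wirtinger derivative `f_z = (f_x - i f_y) / 2`. -/
def dz (f : ℂ → ℂ) (z : ℂ) : ℂ :=
  (fderiv ℝ f z 1 - Complex.I * fderiv ℝ f z Complex.I) / 2

/-- The conjugate Wirtinger derivative, `(f_x + i f_y) / 2`. -/
def dzbar (f : ℂ → ℂ) (z : ℂ) : ℂ :=
  (fderiv ℝ f z 1 + Complex.I * fderiv ℝ f z Complex.I) / 2

/-- The Jacobian: the squared modulus of the first Wirtinger derivative minus that of
the second. -/
def jacobian (f : ℂ → ℂ) (z : ℂ) : ℝ := ‖dz f z‖ ^ 2 - ‖dzbar f z‖ ^ 2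

/-- The dilatation `ω`, the conjugate of `dzbar f` divided by `dz f`. -/
def dilatation (f : ℂ → ℂ) (z : ℂ) : ℂ := (starRingEnd ℂ) (dzbar f z) / dz f z

/-- The pre-Schwarzian derivative `P_f = (log J_f)_z`. -/
def preSchwarzian (f : ℂ → ℂ) : ℂ → ℂ := dz fun w => (Real.log (jacobian f w) : ℂ)

/-- The Schwarzian derivative `S_f = (P_f)_z - (P_f)² / 2`. -/
def schwarzian (f : ℂ → ℂ) (z : ℂ) : ℂ :=
  dz (preSchwarzian f) z - (1 / 2) * preSchwarzian f z ^ 2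

/-- The hyperbolic derivative `(1 - |z|²) ω'(z) / (1 - |ω(z)|²)` of a self-map of the disk. -/
def hyperbolicDeriv (ω : ℂ → ℂ) (z : ℂ) : ℂ :=
  (1 - (‖z‖ : ℂ) ^ 2) * deriv ω z / (1 - (‖ω z‖ : ℂ) ^ 2)

/-- The harmonic order operator `A_f(z) = (1 - |z|²) P_f(z) / 2 - conj z`. -/
def harmonicOrder (f : ℂ → ℂ) (z : ℂ) : ℂ :=
  (1 / 2) * (1 - (‖z‖ : ℂ) ^ 2) * preSchwarzian f z - (starRingEnd ℂ) z

/-- `f` is locally univalent in `U`: every point of `U` has a neighbourhood in `U` on which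
`f` is injective. -/
def LocallyUnivalentOn (f : ℂ → ℂ) (U : Set ℂ) : Prop := IsLocallyInjective (U.domRestrict f)

end PlanarHarmonic

end

open Metric Set Filter Topology ComplexConjugate

namespace PlanarHarmonic

/-! Write `f = h + conj g` with `h`, `g` holomorphic. If `f z = f w`, then `h z - h w` and `g z - g
w` have equal modulus, so `h + a * g` takes equal values at `z` and `w` for some unimodular `a`. It
therefore suffices that every `h + a * g` with `‖a‖ = 1` be injective, and this follows from
Nehari's criterion (`injOn_of_norm_schwarzian_le`).

The Nehari bound comes from an exact identity (`schwarzian_add_mul_identity`). With `R = 1 - |z|²`,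
`H = ω*` and a unimodular `κ`, it says that `R²` times the Schwarzian of `h + a * g` equals `R² S_f
+ κ X - (3/2) κ² H² - 2 κ H A_f`. Here `X` is the invariant second derivative of `ω`, and
second-order Schwarz–Pick gives `|X| ≤ 2 (1 - |H|²)`. The hypothesis bounds the `S_f` and `A_f`
terms by `|H|²/2`, so the total is at most `1/2 + 2 / |H|² - 2 + 3/2` times `|H|²`, which is `2`.

This needs `|g'| < |h'|` everywhere, whereas the bound on `ω` gives it only where `h' ≠ 0`. At
isolated zeros of `h'`, local univalence is contradicted by a blow-up argument
(`deriv_ne_zero_of_injOn`). If `h'` vanishes identically, `f` is antiholomorphic, the hypothesis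
reduces to `S_f = 0`, and Nehari applies to `g`. -/

/-! ### Automorphisms of the unit disk. -/

lemma one_sub_normSq_pos {z : ℂ} (hz : z ∈ ball (0 : ℂ) 1) : 0 < 1 - ‖z‖ ^ 2 := by
  have h : ‖z‖ < 1 := by simpa using hz
  nlinarith [norm_nonneg z]

lemma one_add_mul_ne_zero {a b : ℂ} (ha : ‖a‖ ≤ 1) (hb : ‖b‖ < 1) : 1 + a * b ≠ 0 := by
  intro h
  have h1 : a * b = -1 := by linear_combination h
  have h2 : ‖a‖ * ‖b‖ = 1 := by rw [← norm_mul, h1]; simp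
  nlinarith [norm_nonneg a, norm_nonneg b]

/-- The basic identity for the disk automorphism `w ↦ (w + c) / (1 + conj c * w)`. -/
lemma normSq_one_add_conj_mul_sub (c w : ℂ) :
    ‖1 + conj c * w‖ ^ 2 - ‖w + c‖ ^ 2 = (1 - ‖c‖ ^ 2) * (1 - ‖w‖ ^ 2) := by
  simp only [← Complex.normSq_eq_norm_sq, Complex.normSq_apply]
  simp
  ring

lemma mobius_mem_ball {c w : ℂ} (hc : c ∈ ball (0 : ℂ) 1) (hw : w ∈ ball (0 : ℂ) 1) :
    (w + c) / (1 + conj c * w) ∈ ball (0 : ℂ) 1 := by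
  have h1 := one_sub_normSq_pos hc
  have h2 := one_sub_normSq_pos hw
  have h := normSq_one_add_conj_mul_sub c w
  have hne : 1 + conj c * w ≠ 0 :=
    one_add_mul_ne_zero (by simpa using (mem_ball_zero_iff.1 hc).le) (by simpa using hw)
  have hpos : 0 < ‖1 + conj c * w‖ := norm_pos_iff.2 hne
  rw [mem_ball_zero_iff, norm_div, div_lt_one hpos]
  have := mul_pos h1 h2
  nlinarith [norm_nonneg (w + c)]

lemma one_sub_normSq_mobius {c w : ℂ} (hne : 1 + conj c * w ≠ 0) :
    1 - ‖(w + c) / (1 + conj c * w)‖ ^ 2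
      = (1 - ‖c‖ ^ 2) * (1 - ‖w‖ ^ 2) / ‖1 + conj c * w‖ ^ 2 := by
  have hpos : 0 < ‖1 + conj c * w‖ := norm_pos_iff.2 hne
  rw [← normSq_one_add_conj_mul_sub, norm_div, div_pow, sub_div, div_self (by positivity)]

lemma hasDerivAt_mobius {c w : ℂ} (hne : 1 + conj c * w ≠ 0) :
    HasDerivAt (fun w => (w + c) / (1 + conj c * w))
      ((1 - (‖c‖ : ℂ) ^ 2) / (1 + conj c * w) ^ 2) w := by
  have h1 : HasDerivAt (fun w : ℂ => w + c) 1 w := (hasDerivAt_id w).add_const c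
  have h2 : HasDerivAt (fun w : ℂ => 1 + conj c * w) (conj c) w := by
    simpa using ((hasDerivAt_id w).const_mul (conj c)).const_add 1
  refine (h1.div h2 hne).congr_deriv ?_
  rw [← Complex.conj_mul']
  ring

/-! ### Disconjugacy and Nehari's univalence criterion. -/

/-- A disconjugacy criterion: a solution of `y'' = y₂` with `‖y₂‖ ≤ ‖y‖ / (1 - x²)²` that vanishes
at `0` and at some `r ∈ (0, 1)` has vanishing derivative at `0`. -/
lemma deriv_eq_zero_of_two_zeros {r : ℝ} (hr0 : 0 < r) (hr1 : r < 1) {y y₁ y₂ : ℝ → ℂ}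
    (hy : ∀ x ∈ Icc 0 r, HasDerivAt y (y₁ x) x) (hy₁ : ∀ x ∈ Icc 0 r, HasDerivAt y₁ (y₂ x) x)
    (hq : ∀ x ∈ Icc 0 r, (1 - x ^ 2) ^ 2 * ‖y₂ x‖ ≤ ‖y x‖) (h0 : y 0 = 0) (hr : y r = 0) :
    y₁ 0 = 0 := by
  -- `E = Re (conj y * y') + x / (1 - x²) * |y|²`. The weight is `-w'/w` for the comparison solution
  -- `w = √(1 - x²)` of `w'' = -w / (1 - x²)²`. It makes `E'` the square of `|y' + x y / (1 - x²)|`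
  -- plus a remainder that the bound on `y₂` keeps nonnegative.
  set E : ℝ → ℝ := fun x => ((y x).re * (y₁ x).re + (y x).im * (y₁ x).im)
    + x / (1 - x ^ 2) * ((y x).re ^ 2 + (y x).im ^ 2) with hE
  set E' : ℝ → ℝ := fun x =>
    ((y₁ x).re + x / (1 - x ^ 2) * (y x).re) ^ 2 + ((y₁ x).im + x / (1 - x ^ 2) * (y x).im) ^ 2
      + (((y x).re ^ 2 + (y x).im ^ 2) / (1 - x ^ 2) ^ 2
        + ((y x).re * (y₂ x).re + (y x).im * (y₂ x).im)) with hE'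
  have hpos : ∀ x ∈ Icc 0 r, 0 < 1 - x ^ 2 := fun x hx => by nlinarith [hx.1, hx.2]
  have hderiv : ∀ x ∈ Icc 0 r, HasDerivAt E (E' x) x := by
    intro x hx
    have hp := (hpos x hx).ne'
    have hre : HasDerivAt (fun x => (y x).re) (y₁ x).re x :=
      Complex.reCLM.hasFDerivAt.comp_hasDerivAt x (hy x hx)
    have him : HasDerivAt (fun x => (y x).im) (y₁ x).im x :=
      Complex.imCLM.hasFDerivAt.comp_hasDerivAt x (hy x hx)
    have hre₁ : HasDerivAt (fun x => (y₁ x).re) (y₂ x).re x :=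
      Complex.reCLM.hasFDerivAt.comp_hasDerivAt x (hy₁ x hx)
    have him₁ : HasDerivAt (fun x => (y₁ x).im) (y₂ x).im x :=
      Complex.imCLM.hasFDerivAt.comp_hasDerivAt x (hy₁ x hx)
    have hden : HasDerivAt (fun x : ℝ => 1 - x ^ 2) (-(2 * x)) x := by
      simpa using ((hasDerivAt_id x).pow 2).const_sub 1
    have := ((hre.mul hre₁).add (him.mul him₁)).add
      (((hasDerivAt_id x).div hden hp).mul ((hre.pow 2).add (him.pow 2)))
    refine this.congr_deriv ?_
    simp only [hE', id, Pi.add_apply, Pi.pow_apply, Pi.div_apply]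
    field_simp
    ring
  have hnonneg : ∀ x ∈ Icc 0 r, 0 ≤ E' x := by
    intro x hx
    have hp := hpos x hx
    have hcs : ‖y x‖ * ‖y₂ x‖ ≤ ‖y x‖ ^ 2 / (1 - x ^ 2) ^ 2 := by
      rw [le_div_iff₀ (by positivity)]
      nlinarith [hq x hx, norm_nonneg (y x)]
    have hin : -(‖y x‖ * ‖y₂ x‖) ≤ (y x).re * (y₂ x).re + (y x).im * (y₂ x).im := by
      have h1 := neg_abs_le (conj (y x) * y₂ x).re
      have h2 := Complex.abs_re_le_norm (conj (y x) * y₂ x)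
      rw [norm_mul, Complex.norm_conj] at h2
      simp only [Complex.mul_re, Complex.conj_re, Complex.conj_im] at h1 h2
      linarith
    have hn : (y x).re ^ 2 + (y x).im ^ 2 = ‖y x‖ ^ 2 := by
      rw [← Complex.normSq_eq_norm_sq, Complex.normSq_apply]; ring
    simp only [hE', hn]
    have : 0 ≤ ‖y x‖ ^ 2 / (1 - x ^ 2) ^ 2 + ((y x).re * (y₂ x).re + (y x).im * (y₂ x).im) := by
      linarith
    positivity
  have hmono : MonotoneOn E (Icc 0 r) := by
    refine monotoneOn_of_deriv_nonneg (convex_Icc 0 r)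
      (fun x hx => (hderiv x hx).continuousAt.continuousWithinAt)
      (fun x hx => (hderiv x (interior_subset hx)).differentiableAt.differentiableWithinAt)
      fun x hx => ?_
    rw [(hderiv x (interior_subset hx)).deriv]
    exact hnonneg x (interior_subset hx)
  have hl : (0 : ℝ) ∈ Icc 0 r := ⟨le_rfl, hr0.le⟩
  have hrm : r ∈ Icc 0 r := ⟨hr0.le, le_rfl⟩
  have hE0 : E 0 = 0 := by simp [hE, h0]
  have hEr : E r = 0 := by simp [hE, hr]
  -- A monotone function vanishing at both ends is zero, so `E' 0 = 0`; since `y 0 = 0`, this value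
  -- is `|y₁ 0|²`.
  have hzero : ∀ x ∈ Icc 0 r, E x = 0 := fun x hx =>
    le_antisymm (hEr ▸ hmono hx hrm hx.2) (hE0 ▸ hmono hl hx hx.1)
  have h1 : HasDerivWithinAt E 0 (Icc 0 r) 0 :=
    (hasDerivWithinAt_const (0 : ℝ) (Icc 0 r) (0 : ℝ)).congr hzero hE0
  have h2 : E' 0 = 0 :=
    (uniqueDiffOn_Icc hr0 0 hl).eq_deriv _ (hderiv 0 hl).hasDerivWithinAt h1
  simp only [hE', h0] at h2
  norm_num at h2
  apply Complex.ext <;> simp <;> nlinarith [sq_nonneg (y₁ 0).re, sq_nonneg (y₁ 0).im]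

/-- **Nehari's criterion**: a locally univalent holomorphic function in the unit disk whose
Schwarzian derivative is bounded by `2 / (1 - |z|²)²` is injective. -/
theorem injOn_of_norm_schwarzian_le {φ : ℂ → ℂ} (hφ : DifferentiableOn ℂ φ (ball 0 1))
    (h0 : ∀ z ∈ ball (0 : ℂ) 1, deriv φ z ≠ 0)
    (hS : ∀ z ∈ ball (0 : ℂ) 1, (1 - ‖z‖ ^ 2) ^ 2 * ‖deriv (deriv (deriv φ)) z / deriv φ z
      - 3 / 2 * (deriv (deriv φ) z / deriv φ z) ^ 2‖ ≤ 2) :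
    InjOn φ (ball 0 1) := by
  intro c hc z₂ hz₂ heq
  by_contra hne
  have hφ1 : DifferentiableOn ℂ (deriv φ) (ball 0 1) := hφ.deriv isOpen_ball
  have hφ2 : DifferentiableOn ℂ (deriv (deriv φ)) (ball 0 1) := hφ1.deriv isOpen_ball
  have hder : ∀ {F : ℂ → ℂ}, DifferentiableOn ℂ F (ball 0 1) → ∀ z ∈ ball (0 : ℂ) 1,
      HasDerivAt F (deriv F z) z := fun hF z hz =>
    (hF.differentiableAt (isOpen_ball.mem_nhds hz)).hasDerivAt
  obtain ⟨Λ, hΛ⟩ := (hφ2.div hφ1 h0).isExactOn_ball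
  set p : ℂ → ℂ := fun z => deriv (deriv φ) z / deriv φ z with hp
  set σ : ℂ → ℂ := fun z => deriv (deriv (deriv φ)) z / deriv φ z
      - 3 / 2 * (deriv (deriv φ) z / deriv φ z) ^ 2 with hσ
  -- Since `Λ' = φ''/φ'`, `v` is a branch of `(φ')^(-1/2)` up to a constant factor.
  set v : ℂ → ℂ := fun z => Complex.exp (-Λ z / 2) with hv
  have hv' : ∀ z ∈ ball (0 : ℂ) 1, HasDerivAt v (-(p z / 2) * v z) z := by
    intro z hz
    have h1 : HasDerivAt (fun z => -Λ z / 2) (-(p z) / 2) z := (hΛ z hz).neg.div_const 2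
    refine h1.cexp.congr_deriv ?_
    simp only [hv]; ring
  have hp' : ∀ z ∈ ball (0 : ℂ) 1, HasDerivAt p (σ z + p z ^ 2 / 2) z := by
    intro z hz
    refine ((hder hφ2 z hz).div (hder hφ1 z hz) (h0 z hz)).congr_deriv ?_
    have := h0 z hz
    simp only [hσ, hp]
    field_simp
    ring
  -- `u` solves `u'' = -(σ/2) u` and vanishes at both `c` and `z₂`.
  set u : ℂ → ℂ := fun z => (φ z - φ c) * v z with hu
  set u₁ : ℂ → ℂ := fun z => (deriv φ z - (φ z - φ c) * (p z / 2)) * v z with hu₁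
  have hu' : ∀ z ∈ ball (0 : ℂ) 1, HasDerivAt u (u₁ z) z := by
    intro z hz
    refine (((hder hφ z hz).sub_const _).mul (hv' z hz)).congr_deriv ?_
    simp only [hu₁]; ring
  have hu₁' : ∀ z ∈ ball (0 : ℂ) 1, HasDerivAt u₁ (-(σ z / 2) * u z) z := by
    intro z hz
    refine (((hder hφ1 z hz).sub (((hder hφ z hz).sub_const _).mul
      ((hp' z hz).div_const 2))).mul (hv' z hz)).congr_deriv ?_
    have := h0 z hz
    have hpd : deriv (deriv φ) z = p z * deriv φ z := by simp only [hp]; field_simp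
    simp only [hu, Pi.sub_apply, Pi.mul_apply, hpd]; ring
  -- the geodesic from `c` to `z₂`
  have hcc : -c ∈ ball (0 : ℂ) 1 := by simpa using hc
  set m : ℂ := (z₂ + -c) / (1 + conj (-c) * z₂) with hm
  have hmb : m ∈ ball (0 : ℂ) 1 := mobius_mem_ball hcc hz₂
  have hden : 1 + conj (-c) * z₂ ≠ 0 :=
    one_add_mul_ne_zero (by simpa using (mem_ball_zero_iff.1 hc).le) (by simpa using hz₂)
  have hm0 : m ≠ 0 := by
    rw [hm]
    exact div_ne_zero (fun h => hne (by linear_combination -h)) hden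
  have hmpos : 0 < ‖m‖ := norm_pos_iff.2 hm0
  have hm1 : ‖m‖ < 1 := by simpa using hmb
  set e : ℂ := m / ‖m‖ with he
  have he1 : ‖e‖ = 1 := by simp [he, hmpos.ne']
  have hmem : ∀ x ∈ Icc (0 : ℝ) ‖m‖, (x : ℂ) * e ∈ ball (0 : ℂ) 1 := by
    intro x hx
    rw [mem_ball_zero_iff, norm_mul, he1, mul_one, Complex.norm_real, Real.norm_of_nonneg hx.1]
    exact hx.2.trans_lt hm1
  set T : ℝ → ℂ := fun x => (x * e + c) / (1 + conj c * (x * e)) with hT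
  have hTne : ∀ x ∈ Icc (0 : ℝ) ‖m‖, 1 + conj c * (x * e) ≠ 0 := fun x hx =>
    one_add_mul_ne_zero (by simpa using (mem_ball_zero_iff.1 hc).le) (by simpa using hmem x hx)
  have hTmem : ∀ x ∈ Icc (0 : ℝ) ‖m‖, T x ∈ ball (0 : ℂ) 1 := fun x hx =>
    mobius_mem_ball hc (hmem x hx)
  set κ : ℂ := (1 - (‖c‖ : ℂ) ^ 2) * e with hκ
  have hlin : ∀ x : ℝ, HasDerivAt (fun x : ℝ => (x : ℂ) * e) e x := fun x => by
    simpa using (Complex.ofRealCLM.hasDerivAt (x := x)).mul_const e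
  have hT' : ∀ x ∈ Icc (0 : ℝ) ‖m‖, HasDerivAt T (κ / (1 + conj c * (x * e)) ^ 2) x := by
    intro x hx
    refine ((hasDerivAt_mobius (hTne x hx)).comp x (hlin x)).congr_deriv ?_
    simp only [hκ]; ring
  have hlin' : ∀ x : ℝ, HasDerivAt (fun x : ℝ => 1 + conj c * ((x : ℂ) * e)) (conj c * e) x :=
    fun x => ((hlin x).const_mul _).const_add 1
  refine h0 c hc ?_
  -- The factor `1 + conj c * (x * e)` is `(T')^(-1/2)` up to a constant. It removes the first-order
  -- term from the pulled-back equation, and the bound on `σ` turns into the one required on `[0,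
  -- ‖m‖]` by hyperbolic invariance.
  have key := deriv_eq_zero_of_two_zeros hmpos hm1
    (y := fun x => (1 + conj c * (x * e)) * u (T x))
    (y₁ := fun x => conj c * e * u (T x) + κ / (1 + conj c * (x * e)) * u₁ (T x))
    (y₂ := fun x => κ ^ 2 / (1 + conj c * (x * e)) ^ 3 * (-(σ (T x) / 2) * u (T x)))
    ?_ ?_ ?_ ?_ ?_
  · have hc1 := one_sub_normSq_pos hc
    have hc2 : (1 - (‖c‖ : ℂ) ^ 2) ≠ 0 := by exact_mod_cast hc1.ne'
    have he0 : e ≠ 0 := by rw [← norm_pos_iff, he1]; exact one_pos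
    have hT0 : T 0 = c := by simp [hT]
    simp only [hT0, hu, hu₁, hκ, hv] at key
    simpa [hc2, he0, Complex.exp_ne_zero] using key
  · intro x hx
    refine ((hlin' x).mul ((hu' _ (hTmem x hx)).comp x (hT' x hx))).congr_deriv ?_
    have := hTne x hx
    simp only [Function.comp]
    field_simp
  · intro x hx
    have hn := hTne x hx
    refine ((((hu' _ (hTmem x hx)).comp x (hT' x hx)).const_mul (conj c * e)).add
      (((hasDerivAt_const x κ).div (hlin' x) hn).mul
        ((hu₁' _ (hTmem x hx)).comp x (hT' x hx)))).congr_deriv ?_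
    simp only [Function.comp, Pi.div_apply]
    field_simp
    ring
  · intro x hx
    have hn := hTne x hx
    have hb := hS _ (hTmem x hx)
    have hx1 : ‖(x : ℂ) * e‖ = x := by
      rw [norm_mul, he1, mul_one, Complex.norm_real, Real.norm_of_nonneg hx.1]
    have hT2 : 1 - ‖T x‖ ^ 2
        = (1 - ‖c‖ ^ 2) * (1 - x ^ 2) / ‖1 + conj c * (x * e)‖ ^ 2 := by
      have := one_sub_normSq_mobius hn
      rwa [hx1] at this
    have hκn : ‖κ‖ = 1 - ‖c‖ ^ 2 := by
      rw [hκ, norm_mul, he1, mul_one]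
      have : (1 - (‖c‖ : ℂ) ^ 2) = ((1 - ‖c‖ ^ 2 : ℝ) : ℂ) := by push_cast; rfl
      rw [this, Complex.norm_real, Real.norm_of_nonneg (one_sub_normSq_pos hc).le]
    have hnp : 0 < ‖1 + conj c * (x * e)‖ := norm_pos_iff.2 hn
    change (1 - ‖T x‖ ^ 2) ^ 2 * ‖σ (T x)‖ ≤ 2 at hb
    rw [hT2] at hb
    simp only [norm_mul, norm_div, norm_pow, norm_neg, hκn, Complex.norm_ofNat]
    set N := ‖1 + conj c * (x * e)‖
    have hid : (1 - x ^ 2) ^ 2 * ((1 - ‖c‖ ^ 2) ^ 2 / N ^ 3 * (‖σ (T x)‖ / 2 * ‖u (T x)‖))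
      = (((1 - ‖c‖ ^ 2) * (1 - x ^ 2) / N ^ 2) ^ 2 * ‖σ (T x)‖) / 2 * (N * ‖u (T x)‖) := by
      field_simp
    rw [hid]
    have : 0 ≤ N * ‖u (T x)‖ := by positivity
    nlinarith
  · simp [hT, hu]
  · have hTr : T ‖m‖ = z₂ := by
      have hme : (‖m‖ : ℂ) * e = m := by
        rw [he]; field_simp [show (‖m‖ : ℂ) ≠ 0 by exact_mod_cast hmpos.ne']
      have hd := hTne ‖m‖ ⟨hmpos.le, le_rfl⟩
      simp only [hT]
      rw [div_eq_iff hd, hme]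
      have : m * (1 + conj (-c) * z₂) = z₂ + -c := div_mul_cancel₀ _ hden
      rw [map_neg] at this
      linear_combination this
    rw [hTr]
    simp [hu, heq]

/-! ### First- and second-order Schwarz–Pick inequalities. -/

/-- **Schwarz–Pick** at the origin, for maps into the closed unit disk. -/
lemma norm_deriv_zero_le {χ : ℂ → ℂ} (hχ : DifferentiableOn ℂ χ (ball 0 1))
    (hb : ∀ z ∈ ball (0 : ℂ) 1, ‖χ z‖ ≤ 1) : ‖deriv χ 0‖ ≤ 1 - ‖χ 0‖ ^ 2 := by
  have h00 : (0 : ℂ) ∈ ball (0 : ℂ) 1 := by simp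
  -- Scaling by `s < 1` moves the values into the open disk, where the automorphism sending `s * χ
  -- 0` to `0` is available; the limit `s → 1` is taken at the end.
  have key : ∀ s ∈ Ioo (0 : ℝ) 1, s * ‖deriv χ 0‖ ≤ 1 - s ^ 2 * ‖χ 0‖ ^ 2 := by
    intro s hs
    have hsb : ∀ z ∈ ball (0 : ℂ) 1, (s : ℂ) * χ z ∈ ball (0 : ℂ) 1 := by
      intro z hz
      rw [mem_ball_zero_iff, norm_mul, Complex.norm_real, Real.norm_of_nonneg hs.1.le]
      nlinarith [hb z hz, hs.1, hs.2, norm_nonneg (χ z)]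
    set b : ℂ := -((s : ℂ) * χ 0) with hbdef
    have hbb : b ∈ ball (0 : ℂ) 1 := by
      have := hsb 0 h00
      rwa [hbdef, mem_ball_zero_iff, norm_neg, ← mem_ball_zero_iff]
    have hne : ∀ z ∈ ball (0 : ℂ) 1, 1 + conj b * (s * χ z) ≠ 0 := fun z hz =>
      one_add_mul_ne_zero (by simpa using (mem_ball_zero_iff.1 hbb).le) (by simpa using hsb z hz)
    set Ψ : ℂ → ℂ := fun z => (s * χ z + b) / (1 + conj b * (s * χ z)) with hΨ
    have hder : ∀ z ∈ ball (0 : ℂ) 1, HasDerivAt Ψ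
        ((1 - (‖b‖ : ℂ) ^ 2) / (1 + conj b * (s * χ z)) ^ 2 * (s * deriv χ z)) z := fun z hz =>
      HasDerivAt.comp z (hasDerivAt_mobius (c := b) (hne z hz))
        ((hχ.differentiableAt (isOpen_ball.mem_nhds hz)).hasDerivAt.const_mul (s : ℂ))
    have hΨ0 : Ψ 0 = 0 := by simp [hΨ, hbdef]
    have h1 : ‖deriv Ψ 0‖ ≤ 1 / 1 := by
      refine Complex.norm_deriv_le_div_of_mapsTo_ball
        (fun z hz => (hder z hz).differentiableAt.differentiableWithinAt) ?_ one_pos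
      rw [hΨ0]
      exact fun z hz => ball_subset_closedBall (mobius_mem_ball hbb (hsb z hz))
    have hbp := one_sub_normSq_pos hbb
    have hbn : (1 + conj b * (s * χ 0)) = ((1 - ‖b‖ ^ 2 : ℝ) : ℂ) := by
      have : (s : ℂ) * χ 0 = -b := by simp [hbdef]
      rw [this]
      push_cast
      rw [← Complex.conj_mul']
      ring
    have hbn' : (1 - (‖b‖ : ℂ) ^ 2) = ((1 - ‖b‖ ^ 2 : ℝ) : ℂ) := by push_cast; rfl
    rw [(hder 0 h00).deriv, hbn, hbn', norm_mul, norm_div, norm_pow, Complex.norm_real,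
      Real.norm_of_nonneg hbp.le, norm_mul, Complex.norm_real, Real.norm_of_nonneg hs.1.le] at h1
    have h2 : ‖b‖ ^ 2 = s ^ 2 * ‖χ 0‖ ^ 2 := by
      rw [hbdef, norm_neg, norm_mul, Complex.norm_real, mul_pow, Real.norm_of_nonneg hs.1.le]
    rw [← h2]
    rw [show (1 - ‖b‖ ^ 2) / (1 - ‖b‖ ^ 2) ^ 2 * (s * ‖deriv χ 0‖)
      = s * ‖deriv χ 0‖ / (1 - ‖b‖ ^ 2) by field_simp, div_one, div_le_one hbp] at h1
    exact h1
  have hc : ContinuousWithinAt (fun s : ℝ => s * ‖deriv χ 0‖) (Iio 1) 1 := by fun_prop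
  have hc' : ContinuousWithinAt (fun s : ℝ => 1 - s ^ 2 * ‖χ 0‖ ^ 2) (Iio 1) 1 := by fun_prop
  have := le_of_tendsto_of_tendsto hc hc' ?_
  · simpa using this
  · filter_upwards [Ioo_mem_nhdsLT one_pos] with s hs using key s hs

/-- The second-order Schwarz lemma. -/
lemma norm_deriv_deriv_zero_le {Ω : ℂ → ℂ} (hΩ : DifferentiableOn ℂ Ω (ball 0 1))
    (hb : MapsTo Ω (ball 0 1) (ball 0 1)) (h0 : Ω 0 = 0) :
    ‖deriv (deriv Ω) 0‖ ≤ 2 * (1 - ‖deriv Ω 0‖ ^ 2) := by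
  have h00 : (0 : ℂ) ∈ ball (0 : ℂ) 1 := by simp
  have hnhds : ball (0 : ℂ) 1 ∈ 𝓝 0 := isOpen_ball.mem_nhds h00
  -- Here `Ω z = z * χ z`, so `Ω' 0 = χ 0` and `Ω'' 0 = 2 * χ' 0`. Only `‖χ‖ ≤ 1` is known, as `Ω`
  -- may be a rotation; hence the closed-disk form of Schwarz–Pick.
  set χ := dslope Ω 0 with hχ
  have hd : DifferentiableOn ℂ χ (ball 0 1) := (Complex.differentiableOn_dslope hnhds).2 hΩ
  have hd1 : DifferentiableOn ℂ (deriv χ) (ball 0 1) := hd.deriv isOpen_ball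
  have hle : ∀ z ∈ ball (0 : ℂ) 1, ‖χ z‖ ≤ 1 := by
    intro z hz
    have := Complex.norm_dslope_le_div_of_mapsTo_ball (R₂ := 1) hΩ
      (by rw [h0]; exact hb.mono_right ball_subset_closedBall) hz
    simpa using this
  have hfac : Ω = fun z => z * χ z := by
    funext z
    have := sub_smul_dslope Ω 0 z
    simpa [h0] using this.symm
  have hder : ∀ z ∈ ball (0 : ℂ) 1, HasDerivAt Ω (χ z + z * deriv χ z) z := by
    intro z hz
    rw [hfac]
    refine ((hasDerivAt_id z).mul
      (hd.differentiableAt (isOpen_ball.mem_nhds hz)).hasDerivAt).congr_deriv ?_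
    simp
  have hev : deriv Ω =ᶠ[𝓝 0] fun z => χ z + z * deriv χ z := by
    filter_upwards [hnhds] with z hz using (hder z hz).deriv
  have h2 : HasDerivAt (fun z => χ z + z * deriv χ z) (2 * deriv χ 0) 0 := by
    have h3 := (hd.differentiableAt hnhds).hasDerivAt.add
      ((hasDerivAt_id (0 : ℂ)).mul (hd1.differentiableAt hnhds).hasDerivAt)
    refine h3.congr_deriv ?_
    simp; ring
  rw [hev.deriv_eq, h2.deriv, (hder 0 h00).deriv, norm_mul]
  have := norm_deriv_zero_le hd hle
  simpa using this

/-- The second-order Schwarz–Pick inequality, in invariant form. -/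
theorem norm_second_order_schwarzPick {ω : ℂ → ℂ} (hω : DifferentiableOn ℂ ω (ball 0 1))
    (hb : MapsTo ω (ball 0 1) (ball 0 1)) {c : ℂ} (hc : c ∈ ball (0 : ℂ) 1) :
    ‖((1 - (‖c‖ : ℂ) ^ 2) ^ 2 * (deriv (deriv ω) c
        + 2 * conj (ω c) * deriv ω c ^ 2 / (1 - (‖ω c‖ : ℂ) ^ 2))
        - 2 * conj c * (1 - (‖c‖ : ℂ) ^ 2) * deriv ω c) / (1 - (‖ω c‖ : ℂ) ^ 2)‖
      ≤ 2 * (1 - ‖hyperbolicDeriv ω c‖ ^ 2) := by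
  have h00 : (0 : ℂ) ∈ ball (0 : ℂ) 1 := by simp
  have hω1 : DifferentiableOn ℂ (deriv ω) (ball 0 1) := hω.deriv isOpen_ball
  set b : ℂ := -ω c with hbdef
  have hbb : b ∈ ball (0 : ℂ) 1 := by
    have := hb hc
    rwa [hbdef, mem_ball_zero_iff, norm_neg, ← mem_ball_zero_iff]
  set T : ℂ → ℂ := fun z => (z + c) / (1 + conj c * z) with hT
  have hTmem : ∀ z ∈ ball (0 : ℂ) 1, T z ∈ ball (0 : ℂ) 1 := fun z hz => mobius_mem_ball hc hz
  have hTne : ∀ z ∈ ball (0 : ℂ) 1, 1 + conj c * z ≠ 0 := fun z hz =>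
    one_add_mul_ne_zero (by simpa using (mem_ball_zero_iff.1 hc).le) (by simpa using hz)
  have hne : ∀ z ∈ ball (0 : ℂ) 1, 1 + conj b * ω (T z) ≠ 0 := fun z hz =>
    one_add_mul_ne_zero (by simpa using (mem_ball_zero_iff.1 hbb).le)
      (by simpa using hb (hTmem z hz))
  have hT' : ∀ z ∈ ball (0 : ℂ) 1,
      HasDerivAt T ((1 - (‖c‖ : ℂ) ^ 2) / (1 + conj c * z) ^ 2) z := fun z hz =>
    hasDerivAt_mobius (hTne z hz)
  have hωT : ∀ z ∈ ball (0 : ℂ) 1, HasDerivAt (fun z => ω (T z))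
      (deriv ω (T z) * ((1 - (‖c‖ : ℂ) ^ 2) / (1 + conj c * z) ^ 2)) z := fun z hz =>
    (hω.differentiableAt (isOpen_ball.mem_nhds (hTmem z hz))).hasDerivAt.comp z (hT' z hz)
  -- Composition with automorphisms on both sides normalizes to `Ω 0 = 0`. Then `Ω' 0` is the
  -- hyperbolic derivative at `c`, and `Ω'' 0` is the expression to be bounded.
  set Ω : ℂ → ℂ := fun z => (ω (T z) + b) / (1 + conj b * ω (T z)) with hΩ
  set D : ℂ → ℂ := fun z => (1 - (‖b‖ : ℂ) ^ 2) / (1 + conj b * ω (T z)) ^ 2 *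
    (deriv ω (T z) * ((1 - (‖c‖ : ℂ) ^ 2) / (1 + conj c * z) ^ 2)) with hD
  have hder : ∀ z ∈ ball (0 : ℂ) 1, HasDerivAt Ω (D z) z := fun z hz =>
    HasDerivAt.comp z (hasDerivAt_mobius (c := b) (hne z hz)) (hωT z hz)
  have hT0 : T 0 = c := by simp [hT]
  have hΩ0 : Ω 0 = 0 := by simp [hΩ, hT0, hbdef]
  have hev : deriv Ω =ᶠ[𝓝 0] D := by
    filter_upwards [isOpen_ball.mem_nhds h00] with z hz using (hder z hz).deriv
  have key := norm_deriv_deriv_zero_le (Ω := Ω)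
    (fun z hz => (hder z hz).differentiableAt.differentiableWithinAt)
    (fun z hz => mobius_mem_ball hbb (hb (hTmem z hz))) hΩ0
  have hbn : (‖b‖ : ℂ) ^ 2 = conj b * b := (Complex.conj_mul' b).symm
  have hωn : (‖ω c‖ : ℂ) ^ 2 = conj b * b := by rw [← hbn, hbdef, norm_neg]
  have hω0 : ω c = -b := by simp [hbdef]
  have hW : 1 - conj b * b ≠ 0 := by
    rw [← hbn]
    exact_mod_cast (one_sub_normSq_pos hbb).ne'
  have hD' : HasDerivAt D
      (((1 - (‖c‖ : ℂ) ^ 2) ^ 2 * (deriv (deriv ω) c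
        + 2 * conj (ω c) * deriv ω c ^ 2 / (1 - (‖ω c‖ : ℂ) ^ 2))
        - 2 * conj c * (1 - (‖c‖ : ℂ) ^ 2) * deriv ω c) / (1 - (‖ω c‖ : ℂ) ^ 2)) 0 := by
    have h1 := ((hωT 0 h00).const_mul (conj b)).const_add 1
    have h2 := (hω1.differentiableAt (isOpen_ball.mem_nhds (hTmem 0 h00))).hasDerivAt.comp 0
      (hT' 0 h00)
    have h3 : HasDerivAt (fun z : ℂ => 1 + conj c * z) (conj c) 0 := by
      simpa using ((hasDerivAt_id (0 : ℂ)).const_mul (conj c)).const_add 1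
    have h4 := ((hasDerivAt_const (0 : ℂ) (1 - (‖b‖ : ℂ) ^ 2)).div (h1.pow 2)
      (pow_ne_zero 2 (hne 0 h00))).mul
      (h2.mul ((hasDerivAt_const (0 : ℂ) (1 - (‖c‖ : ℂ) ^ 2)).div (h3.pow 2)
      (pow_ne_zero 2 (hTne 0 h00))))
    refine h4.congr_deriv ?_
    simp only [Function.comp, Pi.pow_apply, Pi.div_apply, Pi.mul_apply, hT0, hωn, hbn]
    simp only [hω0, map_neg]
    have : 1 + conj b * -b ≠ 0 := by rwa [mul_neg, ← sub_eq_add_neg]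
    simp only [mul_zero, add_zero, mul_neg, ← sub_eq_add_neg]
    field_simp
    ring
  have hD0 : D 0 = hyperbolicDeriv ω c := by
    simp only [hD, hyperbolicDeriv, hT0, hωn, hbn]
    simp only [hω0]
    simp only [mul_zero, add_zero, mul_neg, ← sub_eq_add_neg]
    field_simp
  rwa [hev.deriv_eq, hD'.deriv, (hder 0 h00).deriv, hD0] at key

/-! ### Local injectivity and zeros of the analytic part. -/

/-- The real-linear map `w ↦ a w + conj (b w)` has determinant `|a|² - |b|² > 0`. This supplies the
surjectivity needed for the local open mapping argument below. -/
lemma exists_mul_add_conj_mul_eq {a b : ℂ} (hab : ‖b‖ < ‖a‖) (v : ℂ) :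
    ∃ w, a * w + conj (b * w) = v := by
  have h : conj a * a - conj b * b ≠ 0 := by
    rw [Complex.conj_mul', Complex.conj_mul']
    have : ‖a‖ ^ 2 - ‖b‖ ^ 2 ≠ 0 := by nlinarith [norm_nonneg b]
    exact_mod_cast this
  refine ⟨(conj a * v - conj b * conj v) / (conj a * a - conj b * b), ?_⟩
  simp only [map_mul, map_sub, map_div₀, Complex.conj_conj]
  rw [mul_comm a (conj a), mul_comm b (conj b)]
  generalize hd : conj a * a - conj b * b = d at h ⊢
  field_simp
  linear_combination v * hd

/-- The leading-order analysis near a common zero: `z ↦ z ^ N * k z + conj (z ^ N * l z)`, with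
`‖l c‖ < ‖k c‖` and `N ≥ 2`, is not injective near the base point. -/
lemma not_injOn_of_pow_mul {k l : ℂ → ℂ} {c : ℂ} (hk : AnalyticAt ℂ k c) (hl : AnalyticAt ℂ l c)
    (hkl : ‖l c‖ < ‖k c‖) {N : ℕ} (hN : 2 ≤ N) {U : Set ℂ} (hU : U ∈ 𝓝 c) :
    ¬ InjOn (fun z => (z - c) ^ N * k z + conj ((z - c) ^ N * l z)) U := by
  intro hinj
  have hN0 : (N : ℂ) ≠ 0 := by exact_mod_cast (by omega : N ≠ 0)
  obtain ⟨η, hη1, hηN⟩ : ∃ η : ℂ, η ≠ 1 ∧ η ^ N = 1 :=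
    ⟨_, (Complex.isPrimitiveRoot_exp N (by omega)).ne_one (by omega),
      (Complex.isPrimitiveRoot_exp N (by omega)).pow_eq_one⟩
  have hη0 : η ≠ 0 := by
    rintro rfl
    rw [zero_pow (by omega)] at hηN
    exact zero_ne_one hηN
  -- Blow-up at `c`: for real `t`, the map at `c + t ζ` equals `t ^ N * F (t, ζ)`. The limit profile
  -- `F (0, ·)` takes the same value at `1` and at the root of unity `η`.
  set F : ℝ × ℂ → ℂ := fun q => q.2 ^ N * k (c + q.1 * q.2) + conj (q.2 ^ N * l (c + q.1 * q.2))
    with hF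
  have hFc : ∀ ζ : ℂ, ContDiffAt ℝ 1 F (0, ζ) := by
    intro ζ
    have hin : ContDiff ℝ 1 fun q : ℝ × ℂ => c + (q.1 : ℂ) * q.2 :=
      contDiff_const.add ((Complex.ofRealCLM.contDiff.comp contDiff_fst).mul contDiff_snd)
    have hcomp : ∀ {m : ℂ → ℂ}, AnalyticAt ℂ m c →
        ContDiffAt ℝ 1 (fun q : ℝ × ℂ => m (c + (q.1 : ℂ) * q.2)) (0, ζ) := by
      intro m hm
      have h1 : ContDiffAt ℝ 1 m (c + ((0 : ℝ) : ℂ) * ζ) := by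
        simpa using (hm.contDiffAt (n := 1)).restrict_scalars ℝ
      exact h1.comp (0, ζ) hin.contDiffAt
    have hpow : ContDiffAt ℝ 1 (fun q : ℝ × ℂ => q.2 ^ N) (0, ζ) := contDiffAt_snd.pow N
    exact (hpow.mul (hcomp hk)).add
      (Complex.conjCLE.contDiff.contDiffAt.comp (0, ζ) (hpow.mul (hcomp hl)))
  set G : ℝ × ℂ → ℂ := fun q => F q - F (q.1, 1) with hG
  have hGc : ContDiffAt ℝ 1 G (0, η) :=
    (hFc η).sub (ContDiffAt.comp (0, η) (hFc 1) (contDiffAt_fst.prodMk contDiffAt_const))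
  have hGs : HasStrictFDerivAt G (fderiv ℝ G (0, η)) (0, η) :=
    hGc.hasStrictFDerivAt one_ne_zero
  set a : ℂ := N * η ^ (N - 1) * k c with ha
  set b : ℂ := N * η ^ (N - 1) * l c with hb
  have hab : ‖b‖ < ‖a‖ := by
    rw [ha, hb, norm_mul, norm_mul _ (k c)]
    exact mul_lt_mul_of_pos_left hkl (norm_pos_iff.2 (mul_ne_zero hN0 (pow_ne_zero _ hη0)))
  have hpart : ∀ w, fderiv ℝ G (0, η) (0, w) = a * w + conj (b * w) := by
    have h1 : HasFDerivAt (fun ζ => G (0, ζ))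
        ((fderiv ℝ G (0, η)).comp (ContinuousLinearMap.inr ℝ ℝ ℂ)) η :=
      hGs.hasFDerivAt.comp η (hasFDerivAt_prodMk_right (0 : ℝ) η)
    have hp : ∀ m : ℂ, HasFDerivAt (fun ζ : ℂ => ζ ^ N * m)
        ((ContinuousLinearMap.toSpanSingleton ℂ (N * η ^ (N - 1) * m)).restrictScalars ℝ) η := by
      intro m
      have := ((hasDerivAt_pow N η).mul_const m).hasFDerivAt.restrictScalars ℝ
      exact this
    have h2 : HasFDerivAt (fun ζ => G (0, ζ)) _ η :=
      ((hp (k c)).add (Complex.conjCLE.hasFDerivAt.comp η (hp (l c)))).sub_const (F (0, 1))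
        |>.congr_of_eventuallyEq (Eventually.of_forall fun ζ => by simp [hG, hF])
    intro w
    have h3 := DFunLike.congr_fun (h1.unique h2) w
    simp at h3
    rw [h3, ha, hb]
    simp
    ring
  set Ψ : ℝ × ℂ → ℝ × ℂ := fun q => (q.1, G q) with hΨ
  have hΨs : HasStrictFDerivAt Ψ
      ((ContinuousLinearMap.fst ℝ ℝ ℂ).prod (fderiv ℝ G (0, η))) (0, η) :=
    hasStrictFDerivAt_fst.prodMk hGs
  have hsurj : ((ContinuousLinearMap.fst ℝ ℝ ℂ).prod (fderiv ℝ G (0, η))).range = ⊤ := by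
    rw [LinearMap.range_eq_top]
    rintro ⟨s, v⟩
    obtain ⟨w, hw⟩ := exists_mul_add_conj_mul_eq hab (v - fderiv ℝ G (0, η) (s, 0))
    refine ⟨(s, w), ?_⟩
    have hsplit : fderiv ℝ G (0, η) (s, w)
        = fderiv ℝ G (0, η) (s, 0) + fderiv ℝ G (0, η) (0, w) := by
      rw [← map_add]; simp
    simp only [ContinuousLinearMap.coe_coe, ContinuousLinearMap.prod_apply,
      ContinuousLinearMap.coe_fst', hsplit, hpart, hw, add_sub_cancel]
  -- `Ψ` is open at `(0, η)`, so every small `(t, 0)` has a preimage `(t, ζ)` with `ζ` near `η`. For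
  -- `t ≠ 0`, the distinct points `c + t ζ` and `c + t` then have the same image.
  have hmap := hΨs.map_nhds_eq_of_surj hsurj
  have hΨ0 : Ψ (0, η) = (0, 0) := by simp [hΨ, hG, hF, hηN, - map_pow]
  rw [hΨ0] at hmap
  have hS : ∀ᶠ q : ℝ × ℂ in 𝓝 (0, η), c + q.1 * q.2 ∈ U ∧ c + q.1 ∈ U ∧ q.2 ≠ 1 := by
    have h1 : Tendsto (fun q : ℝ × ℂ => c + (q.1 : ℂ) * q.2) (𝓝 (0, η)) (𝓝 c) := by
      have : Continuous fun q : ℝ × ℂ => c + (q.1 : ℂ) * q.2 := by fun_prop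
      simpa using this.tendsto (0, η)
    have h2 : Tendsto (fun q : ℝ × ℂ => c + (q.1 : ℂ)) (𝓝 (0, η)) (𝓝 c) := by
      have : Continuous fun q : ℝ × ℂ => c + (q.1 : ℂ) := by fun_prop
      simpa using this.tendsto (0, η)
    have h3 : ∀ᶠ q : ℝ × ℂ in 𝓝 (0, η), q.2 ≠ 1 :=
      continuous_snd.continuousAt.eventually_ne hη1
    exact (h1.eventually hU).and ((h2.eventually hU).and h3)
  have him : Ψ '' {q | c + q.1 * q.2 ∈ U ∧ c + q.1 ∈ U ∧ q.2 ≠ 1} ∈ 𝓝 ((0 : ℝ), (0 : ℂ)) := by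
    rw [← hmap]
    exact image_mem_map hS
  have ht : ∀ᶠ t : ℝ in 𝓝[≠] 0,
      (t, (0 : ℂ)) ∈ Ψ '' {q | c + q.1 * q.2 ∈ U ∧ c + q.1 ∈ U ∧ q.2 ≠ 1} := by
    have : Continuous fun t : ℝ => (t, (0 : ℂ)) := by fun_prop
    exact ((this.tendsto 0).eventually him).filter_mono nhdsWithin_le_nhds
  obtain ⟨t, ⟨⟨s, ζ⟩, ⟨hq1, hq2, hq3⟩, hq⟩, ht0⟩ := (ht.and self_mem_nhdsWithin).exists
  simp only [hΨ, Prod.mk.injEq] at hq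
  obtain ⟨rfl, hG0⟩ := hq
  simp only at hq1 hq2 hq3
  have ht0' : (s : ℂ) ≠ 0 := by exact_mod_cast ht0
  have heq := hinj hq1 hq2 ?_
  · exact hq3 (mul_left_cancel₀ ht0' (by linear_combination heq))
  · simp only [hG, hF, sub_eq_zero] at hG0
    simp only [add_sub_cancel_left, mul_pow, map_mul, map_pow, Complex.conj_ofReal, one_pow,
      one_mul, mul_one] at hG0 ⊢
    linear_combination (s : ℂ) ^ N * hG0

lemma hasDerivAt_pow_sub_mul {k : ℂ → ℂ} {z c : ℂ} (hk : AnalyticAt ℂ k z) (n : ℕ) :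
    HasDerivAt (fun z => (z - c) ^ (n + 1) * k z)
      ((z - c) ^ n * ((n + 1) * k z + (z - c) * deriv k z)) z := by
  refine ((((hasDerivAt_id z).sub_const c).pow (n + 1)).mul
    hk.differentiableAt.hasDerivAt).congr_deriv ?_
  simp
  ring

lemma deriv_eventuallyEq_of_eq_pow_mul {f k : ℂ → ℂ} {c : ℂ} (hk : AnalyticAt ℂ k c) {n : ℕ}
    (hf : ∀ᶠ z in 𝓝 c, f z - f c = (z - c) ^ (n + 1) * k z) :
    ∀ᶠ z in 𝓝 c, deriv f z = (z - c) ^ n * ((n + 1) * k z + (z - c) * deriv k z) := by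
  filter_upwards [hf.eventually_nhds, hk.eventually_analyticAt] with z hz hkz
  have h1 : f =ᶠ[𝓝 z] fun z => f c + (z - c) ^ (n + 1) * k z := by
    filter_upwards [hz] with w hw
    linear_combination hw
  rw [h1.deriv_eq]
  exact ((hasDerivAt_pow_sub_mul hkz n).const_add (f c)).deriv

/-- An analytic function that is not locally constant factors through a power. -/
lemma exists_sub_eq_pow_mul {f : ℂ → ℂ} {c : ℂ} (hf : AnalyticAt ℂ f c)
    (hne : ¬ ∀ᶠ z in 𝓝 c, f z - f c = 0) :
    ∃ (n : ℕ) (k : ℂ → ℂ), AnalyticAt ℂ k c ∧ k c ≠ 0 ∧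
      ∀ᶠ z in 𝓝 c, f z - f c = (z - c) ^ (n + 1) * k z := by
  obtain ⟨n, k, hk, hk0, hfk⟩ :=
    (hf.sub analyticAt_const).exists_eventuallyEq_pow_smul_nonzero_iff.2 hne
  rcases n with _ | n
  · exact absurd (by simpa using hfk.self_of_nhds.symm) hk0
  · exact ⟨n, k, hk, hk0, by simpa using hfk⟩

/-- The case of **Lewy's theorem** for which the dilatation is a priori bounded by one: if
`h + conj g` is injective near `c` and `‖g'‖ < ‖h'‖` in a punctured neighbourhood of `c`, then
`h' c ≠ 0`. -/
theorem deriv_ne_zero_of_injOn {h g : ℂ → ℂ} {c : ℂ} (hh : AnalyticAt ℂ h c)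
    (hg : AnalyticAt ℂ g c) (hlt : ∀ᶠ z in 𝓝[≠] c, ‖deriv g z‖ < ‖deriv h z‖)
    {U : Set ℂ} (hU : U ∈ 𝓝 c) (hinj : InjOn (fun z => h z + conj (g z)) U) :
    deriv h c ≠ 0 := by
  intro hd
  have hne : ¬ ∀ᶠ z in 𝓝 c, h z - h c = 0 := by
    intro hz
    have h1 : ∀ᶠ z in 𝓝[≠] c, deriv h z = 0 := by
      refine Eventually.filter_mono nhdsWithin_le_nhds ?_
      filter_upwards [hz.eventually_nhds] with z hz'
      have : h =ᶠ[𝓝 z] fun _ => h c := hz'.mono fun w hw => sub_eq_zero.1 hw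
      rw [this.deriv_eq, deriv_const]
    obtain ⟨z, hz1, hz2⟩ := (h1.and hlt).exists
    rw [hz1, norm_zero] at hz2
    exact absurd hz2 (norm_nonneg _).not_gt
  obtain ⟨n, k, hk, hk0, hhk⟩ := exists_sub_eq_pow_mul hh hne
  have hdh := deriv_eventuallyEq_of_eq_pow_mul hk hhk
  have hn : 1 ≤ n := by
    by_contra! hn
    obtain rfl : n = 0 := by omega
    have := hdh.self_of_nhds
    rw [hd] at this
    simp at this
    exact hk0 this.symm
  set K : ℂ → ℂ := fun z => (n + 1) * k z + (z - c) * deriv k z with hK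
  have hn1 : (n : ℂ) + 1 ≠ 0 := by exact_mod_cast n.succ_ne_zero
  have hid : AnalyticAt ℂ (fun z => z - c) c := analyticAt_id.sub analyticAt_const
  have hKan : AnalyticAt ℂ K c :=
    (analyticAt_const.mul hk).add (hid.mul hk.deriv)
  have hKc : K c = (n + 1) * k c := by simp [hK]
  -- `g - g c` vanishes at least to the order of `h - h c`: otherwise, dividing `‖g'‖ < ‖h'‖` by the
  -- lower power and letting `z → c` would force the leading coefficient of `g` to vanish.
  obtain ⟨l, hl, hgl⟩ : ∃ l : ℂ → ℂ, AnalyticAt ℂ l c ∧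
      ∀ᶠ z in 𝓝 c, g z - g c = (z - c) ^ (n + 1) * l z := by
    by_cases hgne : ∀ᶠ z in 𝓝 c, g z - g c = 0
    · exact ⟨0, analyticAt_const, by simpa using hgne⟩
    obtain ⟨m, l, hl, hl0, hgl⟩ := exists_sub_eq_pow_mul hg hgne
    rcases le_or_gt n m with hnm | hnm
    · refine ⟨fun z => (z - c) ^ (m - n) * l z, (hid.pow _).mul hl, ?_⟩
      filter_upwards [hgl] with z hz
      rw [hz, ← mul_assoc, ← pow_add]
      congr 2
      omega
    · exfalso
      have hdg := deriv_eventuallyEq_of_eq_pow_mul hl hgl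
      set L : ℂ → ℂ := fun z => (m + 1) * l z + (z - c) * deriv l z with hL
      have hLan : AnalyticAt ℂ L c := (analyticAt_const.mul hl).add (hid.mul hl.deriv)
      have hle : ∀ᶠ z in 𝓝[≠] c, ‖L z‖ ≤ ‖(z - c) ^ (n - m) * K z‖ := by
        filter_upwards [hlt, hdg.filter_mono nhdsWithin_le_nhds,
          hdh.filter_mono nhdsWithin_le_nhds, self_mem_nhdsWithin] with z h1 h2 h3 h4
        have h4' : 0 < ‖(z - c) ^ m‖ := norm_pos_iff.2 (pow_ne_zero _ (sub_ne_zero.2 h4))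
        have h5 : (z - c) ^ n = (z - c) ^ m * (z - c) ^ (n - m) := by
          rw [← pow_add]; congr 1; omega
        rw [h2, h3, h5, mul_assoc, norm_mul, norm_mul ((z - c) ^ m)] at h1
        exact (lt_of_mul_lt_mul_left h1 h4'.le).le
      have hlim := le_of_tendsto_of_tendsto
        (hLan.continuousAt.norm.tendsto.mono_left nhdsWithin_le_nhds)
        (((hid.pow (n - m)).mul hKan).continuousAt.norm.tendsto.mono_left nhdsWithin_le_nhds) hle
      have hm1 : (m : ℂ) + 1 ≠ 0 := by exact_mod_cast m.succ_ne_zero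
      have hLc : L c = (m + 1) * l c := by simp [hL]
      simp only [Pi.mul_apply, Pi.pow_apply] at hlim
      rw [hLc, sub_self, zero_pow (by omega), zero_mul, norm_zero, norm_le_zero_iff] at hlim
      exact mul_ne_zero hm1 hl0 hlim
  have hdg := deriv_eventuallyEq_of_eq_pow_mul hl hgl
  set L : ℂ → ℂ := fun z => (n + 1) * l z + (z - c) * deriv l z with hL
  have hLan : AnalyticAt ℂ L c := (analyticAt_const.mul hl).add (hid.mul hl.deriv)
  have hLc : L c = (n + 1) * l c := by simp [hL]
  have hLK : ∀ᶠ z in 𝓝[≠] c, ‖L z‖ < ‖K z‖ := by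
    filter_upwards [hlt, hdg.filter_mono nhdsWithin_le_nhds,
      hdh.filter_mono nhdsWithin_le_nhds] with z h1 h2 h3
    rw [h2, h3, norm_mul, norm_mul] at h1
    exact lt_of_mul_lt_mul_left h1 (norm_nonneg _)
  have hK0 : K c ≠ 0 := by rw [hKc]; exact mul_ne_zero hn1 hk0
  have hle : ‖L c‖ ≤ ‖K c‖ := le_of_tendsto_of_tendsto
    (hLan.continuousAt.norm.tendsto.mono_left nhdsWithin_le_nhds)
    (hKan.continuousAt.norm.tendsto.mono_left nhdsWithin_le_nhds) (hLK.mono fun _ h => h.le)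
  have hltc : ‖L c‖ < ‖K c‖ := by
    -- Equality would give `L / K` a local maximum of its modulus at `c`, hence constant modulus `1`
    -- nearby, against strict inequality off `c`.
    refine hle.lt_of_ne fun heq => ?_
    have hq : AnalyticAt ℂ (fun z => L z / K z) c := hLan.div hKan hK0
    have hqc : ‖L c / K c‖ = 1 := by rw [norm_div, heq, div_self (norm_ne_zero_iff.2 hK0)]
    have hq1 : ∀ᶠ z in 𝓝[≠] c, ‖L z / K z‖ < 1 := by
      filter_upwards [hLK] with z hz
      rw [norm_div]
      exact (div_lt_one ((norm_nonneg _).trans_lt hz)).2 hz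
    have hmax : IsLocalMax (norm ∘ fun z => L z / K z) c := by
      have : ∀ᶠ z in 𝓝 c, z ≠ c → ‖L z / K z‖ < 1 := eventually_nhdsWithin_iff.1 hq1
      filter_upwards [this] with z hz
      rcases eq_or_ne z c with rfl | hzc
      · exact le_rfl
      · simpa only [Function.comp, hqc] using (hz hzc).le
    have hconst := Complex.norm_eventually_eq_of_isLocalMax
      (hq.eventually_analyticAt.mono fun z hz => hz.differentiableAt) hmax
    obtain ⟨z, hz1, hz2⟩ := ((hconst.filter_mono nhdsWithin_le_nhds).and hq1).exists
    rw [hz1, hqc] at hz2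
    exact lt_irrefl _ hz2
  rw [hLc, hKc, norm_mul, norm_mul] at hltc
  have hkl : ‖l c‖ < ‖k c‖ := lt_of_mul_lt_mul_left hltc (norm_nonneg _)
  refine not_injOn_of_pow_mul hk hl hkl (show 2 ≤ n + 1 by omega)
    (inter_mem hU (inter_mem hhk hgl)) fun z hz w hw hzw => hinj hz.1 hw.1 ?_
  have e1 : h z - h c = (z - c) ^ (n + 1) * k z := hz.2.1
  have e2 : g z - g c = (z - c) ^ (n + 1) * l z := hz.2.2
  have e3 : h w - h c = (w - c) ^ (n + 1) * k w := hw.2.1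
  have e4 : g w - g c = (w - c) ^ (n + 1) * l w := hw.2.2
  simp only [← e1, ← e2, ← e3, ← e4, map_sub] at hzw
  linear_combination hzw

/-! ### Wirtinger calculus, and the Jacobian, `P_f` and `S_f` in terms of `h` and `g`. -/

/-- `F` is real differentiable at `z`, with Wirtinger derivatives `a` and `b`. -/
def HasWirtingerAt (F : ℂ → ℂ) (a b z : ℂ) : Prop :=
  HasFDerivAt F (a • ContinuousLinearMap.id ℝ ℂ + b • (Complex.conjCLE : ℂ →L[ℝ] ℂ)) z

namespace HasWirtingerAt

variable {F G : ℂ → ℂ} {a b a' b' z : ℂ}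

lemma of_hasFDerivAt {L : ℂ →L[ℝ] ℂ} (hF : HasFDerivAt F L z)
    (hL : ∀ w, L w = a * w + b * conj w) : HasWirtingerAt F a b z := by
  have : L = a • ContinuousLinearMap.id ℝ ℂ + b • (Complex.conjCLE : ℂ →L[ℝ] ℂ) := by
    ext1 w
    simp [hL]
  rwa [HasWirtingerAt, ← this]

lemma dz_eq (hF : HasWirtingerAt F a b z) : dz F z = a := by
  have h := HasFDerivAt.fderiv hF
  simp only [dz, h]
  simp
  linear_combination (b / 2 - a / 2) * Complex.I_sq

lemma dzbar_eq (hF : HasWirtingerAt F a b z) : dzbar F z = b := by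
  have h := HasFDerivAt.fderiv hF
  simp only [dzbar, h]
  simp
  linear_combination (a / 2 - b / 2) * Complex.I_sq

lemma congr (hF : HasWirtingerAt F a b z) (h : G =ᶠ[𝓝 z] F) : HasWirtingerAt G a b z :=
  HasFDerivAt.congr_of_eventuallyEq hF h

lemma of_hasDerivAt (hF : HasDerivAt F a z) : HasWirtingerAt F a 0 z :=
  of_hasFDerivAt (hF.hasFDerivAt.restrictScalars ℝ) fun w => by simp [mul_comm]

lemma conj_of_hasDerivAt (hF : HasDerivAt F a z) :
    HasWirtingerAt (fun w => conj (F w)) 0 (conj a) z :=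
  of_hasFDerivAt (Complex.conjCLE.hasFDerivAt.comp z (hF.hasFDerivAt.restrictScalars ℝ))
    fun w => by simp [mul_comm]

lemma add (hF : HasWirtingerAt F a b z) (hG : HasWirtingerAt G a' b' z) :
    HasWirtingerAt (fun w => F w + G w) (a + a') (b + b') z :=
  of_hasFDerivAt (HasFDerivAt.add hF hG) fun w => by simp; ring

lemma sub (hF : HasWirtingerAt F a b z) (hG : HasWirtingerAt G a' b' z) :
    HasWirtingerAt (fun w => F w - G w) (a - a') (b - b') z :=
  of_hasFDerivAt (HasFDerivAt.sub hF hG) fun w => by simp; ring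

lemma mul (hF : HasWirtingerAt F a b z) (hG : HasWirtingerAt G a' b' z) :
    HasWirtingerAt (fun w => F w * G w) (a * G z + F z * a') (b * G z + F z * b') z :=
  of_hasFDerivAt (HasFDerivAt.mul hF hG) fun w => by simp; ring

lemma inv (hF : HasWirtingerAt F a b z) (h0 : F z ≠ 0) :
    HasWirtingerAt (fun w => (F w)⁻¹) (-a / F z ^ 2) (-b / F z ^ 2) z :=
  of_hasFDerivAt (((hasDerivAt_inv h0).hasFDerivAt.restrictScalars ℝ).comp z hF)
    fun w => by simp; field_simp

lemma log {j : ℂ → ℝ} (hj : HasWirtingerAt (fun w => (j w : ℂ)) a b z) (h0 : j z ≠ 0) :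
    HasWirtingerAt (fun w => (Real.log (j w) : ℂ)) (a / j z) (b / j z) z := by
  have h1 : HasFDerivAt j (Complex.reCLM.comp
      (a • ContinuousLinearMap.id ℝ ℂ + b • (Complex.conjCLE : ℂ →L[ℝ] ℂ))) z :=
    HasFDerivAt.comp (g := Complex.reCLM) z (Complex.reCLM.hasFDerivAt (x := (j z : ℂ))) hj
  have h2 := Complex.ofRealCLM.hasFDerivAt.comp z h1
  refine of_hasFDerivAt (Complex.ofRealCLM.hasFDerivAt.comp z (h1.log h0)) fun w => ?_
  -- Uniqueness of the derivative shows that `a * w + b * conj w` equals its own real part, because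
  -- `j` is real-valued.
  have h3 := DFunLike.congr_fun (HasFDerivAt.unique h2 hj) w
  simp only [ContinuousLinearMap.comp_apply, add_apply,
    smul_apply, ContinuousLinearMap.id_apply, smul_eq_mul,
    ContinuousLinearEquiv.coe_coe, Complex.conjCLE_apply, Complex.ofRealCLM_apply,
    Complex.ofReal_mul, Complex.ofReal_inv] at h3 ⊢
  rw [h3]
  ring

end HasWirtingerAt

section Decomposition

variable {f h g : ℂ → ℂ} {U : Set ℂ}

lemma hasWirtingerAt_add_conj (hU : IsOpen U) (hh : DifferentiableOn ℂ h U)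
    (hg : DifferentiableOn ℂ g U) (hf : EqOn f (fun z => h z + conj (g z)) U) {z : ℂ}
    (hz : z ∈ U) : HasWirtingerAt f (deriv h z) (conj (deriv g z)) z := by
  have hn := hU.mem_nhds hz
  have := (HasWirtingerAt.of_hasDerivAt (hh.differentiableAt hn).hasDerivAt).add
    (HasWirtingerAt.conj_of_hasDerivAt (hg.differentiableAt hn).hasDerivAt)
  rw [add_zero, zero_add] at this
  exact this.congr (hf.eventuallyEq_of_mem hn)

/-- The Jacobian and its `z`-derivative both have this form, so one rule serves for `P_f` and for
`S_f`. -/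
lemma hasWirtingerAt_hermitian {p q r s : ℂ → ℂ} (hU : IsOpen U)
    (hp : DifferentiableOn ℂ p U) (hq : DifferentiableOn ℂ q U) (hr : DifferentiableOn ℂ r U)
    (hs : DifferentiableOn ℂ s U) {z : ℂ} (hz : z ∈ U) :
    HasWirtingerAt (fun z => p z * conj (q z) - r z * conj (s z))
      (deriv p z * conj (q z) - deriv r z * conj (s z))
      (p z * conj (deriv q z) - r z * conj (deriv s z)) z := by
  have hn := hU.mem_nhds hz
  have := ((HasWirtingerAt.of_hasDerivAt (hp.differentiableAt hn).hasDerivAt).mul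
    (HasWirtingerAt.conj_of_hasDerivAt (hq.differentiableAt hn).hasDerivAt)).sub
    ((HasWirtingerAt.of_hasDerivAt (hr.differentiableAt hn).hasDerivAt).mul
    (HasWirtingerAt.conj_of_hasDerivAt (hs.differentiableAt hn).hasDerivAt))
  simpa using this

lemma ofReal_jacobian (hU : IsOpen U) (hh : DifferentiableOn ℂ h U)
    (hg : DifferentiableOn ℂ g U) (hf : EqOn f (fun z => h z + conj (g z)) U) {z : ℂ}
    (hz : z ∈ U) : (jacobian f z : ℂ)
      = deriv h z * conj (deriv h z) - deriv g z * conj (deriv g z) := by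
  have hw := hasWirtingerAt_add_conj hU hh hg hf hz
  rw [jacobian, hw.dz_eq, hw.dzbar_eq, Complex.norm_conj, Complex.mul_conj', Complex.mul_conj']
  push_cast
  rfl

lemma dilatation_eq (hU : IsOpen U) (hh : DifferentiableOn ℂ h U)
    (hg : DifferentiableOn ℂ g U) (hf : EqOn f (fun z => h z + conj (g z)) U) {z : ℂ}
    (hz : z ∈ U) : dilatation f z = deriv g z / deriv h z := by
  have hw := hasWirtingerAt_add_conj hU hh hg hf hz
  rw [dilatation, hw.dz_eq, hw.dzbar_eq, Complex.conj_conj]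

lemma preSchwarzian_eq (hU : IsOpen U) (hh : DifferentiableOn ℂ h U)
    (hg : DifferentiableOn ℂ g U) (hf : EqOn f (fun z => h z + conj (g z)) U) {z : ℂ}
    (hz : z ∈ U) (hJ : jacobian f z ≠ 0) : preSchwarzian f z
      = (deriv (deriv h) z * conj (deriv h z) - deriv (deriv g) z * conj (deriv g z))
        / (deriv h z * conj (deriv h z) - deriv g z * conj (deriv g z)) := by
  have h1 := (hasWirtingerAt_hermitian hU (hh.deriv hU) (hh.deriv hU) (hg.deriv hU)
    (hg.deriv hU) hz).congr (G := fun w => (jacobian f w : ℂ)) <| by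
      filter_upwards [hU.mem_nhds hz] with w hw using ofReal_jacobian hU hh hg hf hw
  rw [preSchwarzian, (h1.log hJ).dz_eq, ofReal_jacobian hU hh hg hf hz]

/-- Differentiating `1 / J_f` in `P_f = (J_f)_z / J_f` contributes `-P_f²`, and the definition
another `-P_f² / 2`; hence the coefficient `3 / 2`. -/
lemma schwarzian_eq (hU : IsOpen U) (hh : DifferentiableOn ℂ h U)
    (hg : DifferentiableOn ℂ g U) (hf : EqOn f (fun z => h z + conj (g z)) U)
    (hJ : ∀ z ∈ U, jacobian f z ≠ 0) {z : ℂ} (hz : z ∈ U) : schwarzian f z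
      = (deriv (deriv (deriv h)) z * conj (deriv h z)
          - deriv (deriv (deriv g)) z * conj (deriv g z))
          / (deriv h z * conj (deriv h z) - deriv g z * conj (deriv g z))
        - 3 / 2 * preSchwarzian f z ^ 2 := by
  have hh1 := hh.deriv hU
  have hg1 := hg.deriv hU
  have hne : deriv h z * conj (deriv h z) - deriv g z * conj (deriv g z) ≠ 0 := by
    rw [← ofReal_jacobian hU hh hg hf hz]
    exact_mod_cast hJ z hz
  have h1 := ((hasWirtingerAt_hermitian hU (hh1.deriv hU) hh1 (hg1.deriv hU) hg1 hz).mul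
    ((hasWirtingerAt_hermitian hU hh1 hh1 hg1 hg1 hz).inv hne)).congr
    (G := preSchwarzian f) <| by
      filter_upwards [hU.mem_nhds hz] with w hw
      rw [preSchwarzian_eq hU hh hg hf hw (hJ w hw), div_eq_mul_inv]
  rw [schwarzian, h1.dz_eq, preSchwarzian_eq hU hh hg hf hz (hJ z hz)]
  field_simp
  ring

end Decomposition

/-- A complex harmonic function on a disk is `h + conj g` with `h` and `g` holomorphic. -/
theorem exists_eqOn_add_conj {f : ℂ → ℂ} {c : ℂ} {R : ℝ}
    (hf : InnerProductSpace.HarmonicOnNhd f (ball c R)) :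
    ∃ h g : ℂ → ℂ, DifferentiableOn ℂ h (ball c R) ∧ DifferentiableOn ℂ g (ball c R) ∧
      EqOn f (fun z => h z + conj (g z)) (ball c R) := by
  obtain ⟨p, hp, hpf⟩ :=
    InnerProductSpace.HarmonicOnNhd.exists_analyticOnNhd_ball_re_eq (hf.comp_CLM Complex.reCLM)
  obtain ⟨q, hq, hqf⟩ :=
    InnerProductSpace.HarmonicOnNhd.exists_analyticOnNhd_ball_re_eq (hf.comp_CLM Complex.imCLM)
  have hp' := hp.differentiableOn
  have hq' := hq.differentiableOn
  -- With `Re p = Re f` and `Re q = Im f`, one has `f = (p + conj p) / 2 + i (q + conj q) / 2`; the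
  -- holomorphic and antiholomorphic terms are grouped.
  refine ⟨fun z => (p z + Complex.I * q z) / 2, fun z => (p z - Complex.I * q z) / 2,
    (hp'.add (hq'.const_mul _)).div_const 2, (hp'.sub (hq'.const_mul _)).div_const 2,
    fun z hz => ?_⟩
  have h1 : (p z).re = (f z).re := hpf hz
  have h2 : (q z).re = (f z).im := hqf hz
  rw [← Complex.re_add_im (f z), ← h1, ← h2]
  apply Complex.ext <;> simp [map_ofNat] <;> ring

/-! ### Comparison with the holomorphic functions `h + a * g`. -/

/-- The Schwarzian derivative of `h + a * g` in terms of that of `h + conj g`. The data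
`A, A₁, A₂` are `h', h'', h'''` at a point, `w, w₁, w₂` are the dilatation and its derivatives,
and `v` stands for the conjugate of `w`. -/
lemma schwarzian_add_mul_identity {A A₁ A₂ w w₁ w₂ v a ζ R : ℂ} (hA : A ≠ 0)
    (hW : 1 - w * v ≠ 0) (ha : 1 + a * w ≠ 0) :
    R ^ 2 * ((A₂ + a * (w₂ * A + 2 * w₁ * A₁ + w * A₂)) / (A * (1 + a * w))
        - 3 / 2 * ((A₁ + a * (w₁ * A + w * A₁)) / (A * (1 + a * w))) ^ 2)
      = R ^ 2 * ((A₂ - v * (w₂ * A + 2 * w₁ * A₁ + w * A₂)) / (A * (1 - w * v))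
          - 3 / 2 * ((A₁ - v * (w₁ * A + w * A₁)) / (A * (1 - w * v))) ^ 2)
        + (a + v) / (1 + a * w)
          * ((R ^ 2 * (w₂ + 2 * v * w₁ ^ 2 / (1 - w * v)) - 2 * ζ * R * w₁) / (1 - w * v))
        - 3 / 2 * ((a + v) / (1 + a * w)) ^ 2 * (R * w₁ / (1 - w * v)) ^ 2
        - 2 * ((a + v) / (1 + a * w)) * (R * w₁ / (1 - w * v)
          * (1 / 2 * R * ((A₁ - v * (w₁ * A + w * A₁)) / (A * (1 - w * v))) - ζ)) := by
  field_simp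
  ring

/-- This quotient is the coefficient `κ` in `schwarzian_add_mul_identity`; being unimodular, it
drops out of the estimate. -/
lemma norm_add_conj_div {a w : ℂ} (ha : ‖a‖ = 1) (hw : 1 + a * w ≠ 0) :
    ‖(a + conj w) / (1 + a * w)‖ = 1 := by
  have h1 : a + conj w = a * conj (1 + a * w) := by
    have : a * conj a = 1 := by rw [Complex.mul_conj', ha]; norm_num
    simp only [map_add, map_one, map_mul]
    linear_combination -conj w * this
  rw [h1, norm_div, norm_mul, ha, one_mul, Complex.norm_conj,
    div_self (norm_ne_zero_iff.2 hw)]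

/-- If the Schwarzian derivative of `f = h + conj g` satisfies the bound of the univalence
criterion, then every `h + a * g` with `‖a‖ = 1` satisfies the Nehari bound. -/
lemma norm_schwarzian_add_mul_le {f h g : ℂ → ℂ} (hh : DifferentiableOn ℂ h (ball 0 1))
    (hg : DifferentiableOn ℂ g (ball 0 1))
    (hf : EqOn f (fun z => h z + conj (g z)) (ball 0 1))
    (hlt : ∀ z ∈ ball (0 : ℂ) 1, ‖deriv g z‖ < ‖deriv h z‖)
    (hineq : ∀ z ∈ ball (0 : ℂ) 1,
      (1 - ‖z‖ ^ 2) ^ 2 * ‖schwarzian f z‖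
        + 2 * ‖hyperbolicDeriv (dilatation f) z * harmonicOrder f z‖
        ≤ (1 / 2) * ‖hyperbolicDeriv (dilatation f) z‖ ^ 2)
    {a : ℂ} (ha : ‖a‖ = 1) {z : ℂ} (hz : z ∈ ball (0 : ℂ) 1) :
    (1 - ‖z‖ ^ 2) ^ 2
      * ‖(deriv (deriv (deriv h)) z + a * deriv (deriv (deriv g)) z) / (deriv h z + a * deriv g z)
        - 3 / 2 * ((deriv (deriv h) z + a * deriv (deriv g) z)
          / (deriv h z + a * deriv g z)) ^ 2‖ ≤ 2 := by
  set U := ball (0 : ℂ) 1 with hUdef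
  have hU : IsOpen U := isOpen_ball
  have hh1 := hh.deriv hU
  have hh2 := hh1.deriv hU
  have hh0 : ∀ z ∈ U, deriv h z ≠ 0 := fun z hz =>
    norm_pos_iff.1 ((norm_nonneg _).trans_lt (hlt z hz))
  set ω : ℂ → ℂ := dilatation f with hω
  have hωeq : EqOn ω (fun z => deriv g z / deriv h z) U := fun z hz =>
    dilatation_eq hU hh hg hf hz
  have hωd : DifferentiableOn ℂ ω U := ((hg.deriv hU).div hh1 hh0).congr hωeq
  have hω1d : DifferentiableOn ℂ (deriv ω) U := hωd.deriv hU
  have hωmaps : MapsTo ω U (ball 0 1) := by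
    intro z hz
    rw [hωeq hz, mem_ball_zero_iff, norm_div]
    exact (div_lt_one ((norm_nonneg _).trans_lt (hlt z hz))).2 (hlt z hz)
  have hder : ∀ {F : ℂ → ℂ}, DifferentiableOn ℂ F U → ∀ z ∈ U, HasDerivAt F (deriv F z) z :=
    fun hF z hz => (hF.differentiableAt (hU.mem_nhds hz)).hasDerivAt
  have hg1 : ∀ z ∈ U, deriv g z = ω z * deriv h z := fun z hz => by
    rw [hωeq hz]
    exact (div_mul_cancel₀ _ (hh0 z hz)).symm
  have hg2 : ∀ z ∈ U, deriv (deriv g) z = deriv ω z * deriv h z + ω z * deriv (deriv h) z := by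
    intro z hz
    have : deriv g =ᶠ[𝓝 z] fun z => ω z * deriv h z := by
      filter_upwards [hU.mem_nhds hz] with w hw using hg1 w hw
    rw [this.deriv_eq]
    exact ((hder hωd z hz).mul (hder hh1 z hz)).deriv
  have hg3 : deriv (deriv (deriv g)) z = deriv (deriv ω) z * deriv h z
      + 2 * deriv ω z * deriv (deriv h) z + ω z * deriv (deriv (deriv h)) z := by
    have : deriv (deriv g) =ᶠ[𝓝 z]
        fun z => deriv ω z * deriv h z + ω z * deriv (deriv h) z := by
      filter_upwards [hU.mem_nhds hz] with w hw using hg2 w hw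
    rw [this.deriv_eq]
    refine ((((hder hω1d z hz).mul (hder hh1 z hz)).add
      ((hder hωd z hz).mul (hder hh2 z hz))).congr_deriv ?_).deriv
    ring
  have hJ : ∀ z ∈ U, jacobian f z ≠ 0 := by
    intro z hz
    have hw := hasWirtingerAt_add_conj hU hh hg hf hz
    rw [jacobian, hw.dz_eq, hw.dzbar_eq, Complex.norm_conj]
    nlinarith [hlt z hz, norm_nonneg (deriv g z)]
  have hA := hh0 z hz
  have hA' : conj (deriv h z) ≠ 0 := (map_ne_zero _).2 hA
  have hwv : (‖ω z‖ : ℂ) ^ 2 = ω z * conj (ω z) := (Complex.mul_conj' _).symm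
  have hW : 1 - ω z * conj (ω z) ≠ 0 := by
    rw [← hwv]
    exact_mod_cast (one_sub_normSq_pos (hωmaps hz)).ne'
  have haw : 1 + a * ω z ≠ 0 :=
    one_add_mul_ne_zero ha.le (by simpa using hωmaps hz)
  have hP : preSchwarzian f z = (deriv (deriv h) z
      - conj (ω z) * (deriv ω z * deriv h z + ω z * deriv (deriv h) z))
        / (deriv h z * (1 - ω z * conj (ω z))) := by
    rw [preSchwarzian_eq hU hh hg hf hz (hJ z hz), hg2 z hz, hg1 z hz, map_mul,
      show deriv h z * conj (deriv h z) - ω z * deriv h z * (conj (ω z) * conj (deriv h z))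
        = conj (deriv h z) * (deriv h z * (1 - ω z * conj (ω z))) by ring]
    rw [div_eq_div_iff (mul_ne_zero hA' (mul_ne_zero hA hW)) (mul_ne_zero hA hW)]
    ring
  have hSf : schwarzian f z = (deriv (deriv (deriv h)) z
      - conj (ω z) * (deriv (deriv ω) z * deriv h z + 2 * deriv ω z * deriv (deriv h) z
        + ω z * deriv (deriv (deriv h)) z)) / (deriv h z * (1 - ω z * conj (ω z)))
      - 3 / 2 * ((deriv (deriv h) z
      - conj (ω z) * (deriv ω z * deriv h z + ω z * deriv (deriv h) z))
        / (deriv h z * (1 - ω z * conj (ω z)))) ^ 2 := by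
    rw [schwarzian_eq hU hh hg hf hJ hz, hP, hg3, hg1 z hz, map_mul,
      show deriv h z * conj (deriv h z) - ω z * deriv h z * (conj (ω z) * conj (deriv h z))
        = conj (deriv h z) * (deriv h z * (1 - ω z * conj (ω z))) by ring]
    congr 1
    rw [div_eq_div_iff (mul_ne_zero hA' (mul_ne_zero hA hW)) (mul_ne_zero hA hW)]
    ring
  have hid := schwarzian_add_mul_identity (A₁ := deriv (deriv h) z)
    (A₂ := deriv (deriv (deriv h)) z) (w₁ := deriv ω z) (w₂ := deriv (deriv ω) z)
    (ζ := conj z) (R := 1 - (‖z‖ : ℂ) ^ 2) hA hW haw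
  have hX := norm_second_order_schwarzPick hωd hωmaps hz
  have hκ := norm_add_conj_div ha haw
  have hHdef : hyperbolicDeriv ω z
      = (1 - (‖z‖ : ℂ) ^ 2) * deriv ω z / (1 - ω z * conj (ω z)) := by
    rw [hyperbolicDeriv, hwv]
  have hord : harmonicOrder f z = 1 / 2 * (1 - (‖z‖ : ℂ) ^ 2) * preSchwarzian f z - conj z := rfl
  rw [← hSf, ← hP, ← hHdef, ← hord] at hid
  rw [hwv] at hX
  have hlhs : (deriv h z + a * deriv g z) = deriv h z * (1 + a * ω z) := by
    rw [hg1 z hz]; ring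
  rw [hlhs, hg3, hg2 z hz]
  have hR : (1 - ‖z‖ ^ 2) ^ 2 = ‖(1 - (‖z‖ : ℂ) ^ 2) ^ 2‖ := by
    have : (1 - (‖z‖ : ℂ) ^ 2) = ((1 - ‖z‖ ^ 2 : ℝ) : ℂ) := by push_cast; rfl
    rw [this, norm_pow, Complex.norm_real, Real.norm_of_nonneg (one_sub_normSq_pos hz).le]
  have hineqz := hineq z hz
  rw [hR] at hineqz ⊢
  rw [← norm_mul, hid]
  rw [← norm_mul] at hineqz
  generalize (a + conj (ω z)) / (1 + a * ω z) = κ at hκ ⊢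
  -- With `H` the hyperbolic derivative, the four terms total at most `|H|²/2 + 2 (1 - |H|²) + (3/2)
  -- |H|² = 2`: the first and last are bounded together by the hypothesis, the second by
  -- Schwarz–Pick.
  refine (norm_sub_le _ _).trans ?_
  refine (add_le_add_left (norm_sub_le _ _) _).trans ?_
  refine (add_le_add_left (add_le_add_left (norm_add_le _ _) _) _).trans ?_
  rw [norm_mul κ, norm_mul (2 * κ), norm_mul _ (hyperbolicDeriv ω z ^ 2), norm_mul _ (κ ^ 2),
    norm_mul 2 κ, norm_pow, norm_pow, hκ]
  norm_num
  norm_num at hX hineqz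
  linarith

/-- A sense-preserving harmonic mapping of the disk that satisfies the Schwarzian bound is
injective. -/
theorem injOn_of_sensePreserving {f h g : ℂ → ℂ} (hh : DifferentiableOn ℂ h (ball 0 1))
    (hg : DifferentiableOn ℂ g (ball 0 1))
    (hf : EqOn f (fun z => h z + conj (g z)) (ball 0 1))
    (hlt : ∀ z ∈ ball (0 : ℂ) 1, ‖deriv g z‖ < ‖deriv h z‖)
    (hineq : ∀ z ∈ ball (0 : ℂ) 1,
      (1 - ‖z‖ ^ 2) ^ 2 * ‖schwarzian f z‖
        + 2 * ‖hyperbolicDeriv (dilatation f) z * harmonicOrder f z‖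
        ≤ (1 / 2) * ‖hyperbolicDeriv (dilatation f) z‖ ^ 2) :
    InjOn f (ball 0 1) := by
  have hinj : ∀ a : ℂ, ‖a‖ = 1 → InjOn (fun z => h z + a * g z) (ball 0 1) := by
    intro a ha
    have hd : ∀ {p q : ℂ → ℂ}, DifferentiableOn ℂ p (ball 0 1) → DifferentiableOn ℂ q (ball 0 1) →
        ∀ z ∈ ball (0 : ℂ) 1, HasDerivAt (fun z => p z + a * q z) (deriv p z + a * deriv q z) z :=
      fun hp hq z hz => ((hp.differentiableAt (isOpen_ball.mem_nhds hz)).hasDerivAt).add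
        ((hq.differentiableAt (isOpen_ball.mem_nhds hz)).hasDerivAt.const_mul a)
    have hlift : ∀ {F p q : ℂ → ℂ}, DifferentiableOn ℂ p (ball 0 1) →
        DifferentiableOn ℂ q (ball 0 1) → (∀ z ∈ ball (0 : ℂ) 1, F z = p z + a * q z) →
        ∀ z ∈ ball (0 : ℂ) 1, deriv F z = deriv p z + a * deriv q z := by
      intro F p q hp hq hF z hz
      have : F =ᶠ[𝓝 z] fun z => p z + a * q z := by
        filter_upwards [isOpen_ball.mem_nhds hz] with w hw using hF w hw
      rw [this.deriv_eq, (hd hp hq z hz).deriv]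
    have hh1 := hh.deriv isOpen_ball
    have hg1 := hg.deriv isOpen_ball
    have e1 := hlift (F := fun z => h z + a * g z) hh hg fun _ _ => rfl
    have e2 := hlift hh1 hg1 e1
    have e3 := hlift (hh1.deriv isOpen_ball) (hg1.deriv isOpen_ball) e2
    refine injOn_of_norm_schwarzian_le (hh.add (hg.const_mul a)) (fun z hz h0 => ?_)
      fun z hz => ?_
    · rw [e1 z hz] at h0
      have h1 : deriv h z = -(a * deriv g z) := by linear_combination h0
      have h2 := hlt z hz
      rw [h1, norm_neg, norm_mul, ha, one_mul] at h2
      exact lt_irrefl _ h2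
    · rw [e1 z hz, e2 z hz, e3 z hz]
      exact norm_schwarzian_add_mul_le hh hg hf hlt hineq ha hz
  intro z hz w hw hzw
  rw [hf hz, hf hw] at hzw
  have hsub : h z - h w = -conj (g z - g w) := by
    rw [map_sub]
    linear_combination hzw
  by_cases hgzw : g z - g w = 0
  · rw [hgzw, map_zero, neg_zero] at hsub
    exact hinj 1 norm_one hz hw (by linear_combination hsub + hgzw)
  -- The unimodular `a` depends on the pair `z, w`: it is chosen so that `a * (g z - g w) = conj (g
  -- z - g w)`.
  · refine hinj (conj (g z - g w) / (g z - g w)) ?_ hz hw ?_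
    · rw [norm_div, Complex.norm_conj, div_self (norm_ne_zero_iff.2 hgzw)]
    · have := div_mul_cancel₀ (conj (g z - g w)) hgzw
      linear_combination hsub + this

/-! ### Zeros of `h'` and the antiholomorphic case. -/

/-- If `p` is analytic on a preconnected open set, it vanishes there identically or its zeros
are isolated. -/
lemma eqOn_zero_or_forall_eventually_ne {p : ℂ → ℂ} {U : Set ℂ} (hp : AnalyticOnNhd ℂ p U)
    (hU : IsPreconnected U) : EqOn p 0 U ∨ ∀ c ∈ U, ∀ᶠ z in 𝓝[≠] c, p z ≠ 0 := by
  by_cases h : ∃ c ∈ U, ∀ᶠ z in 𝓝 c, p z = 0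
  · obtain ⟨c, hc, hpc⟩ := h
    exact Or.inl (hp.eqOn_zero_of_preconnected_of_eventuallyEq_zero hU hc hpc)
  · push Not at h
    exact Or.inr fun c hc =>
      ((hp c hc).eventually_eq_zero_or_eventually_ne_zero).resolve_left
        (not_eventually.2 (h c hc))

lemma LocallyUnivalentOn.exists_mem_nhds {f : ℂ → ℂ} {U : Set ℂ} (hf : LocallyUnivalentOn f U)
    (hU : IsOpen U) {c : ℂ} (hc : c ∈ U) : ∃ V ∈ 𝓝 c, V ⊆ U ∧ InjOn f V := by
  obtain ⟨W, hWo, hcW, hW⟩ := hf ⟨c, hc⟩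
  refine ⟨Subtype.val '' W, (hU.isOpenMap_subtype_val W hWo).mem_nhds ⟨_, hcW, rfl⟩,
    by rintro _ ⟨x, -, rfl⟩; exact x.2, ?_⟩
  rintro _ ⟨x, hx, rfl⟩ _ ⟨y, hy, rfl⟩ hxy
  exact congrArg Subtype.val (hW hx hy hxy)

/-- A locally univalent antiholomorphic mapping of the disk with vanishing Schwarzian derivative
is injective. -/
theorem injOn_of_antiholomorphic {f h g : ℂ → ℂ} (hh : DifferentiableOn ℂ h (ball 0 1))
    (hg : DifferentiableOn ℂ g (ball 0 1))
    (hf : EqOn f (fun z => h z + conj (g z)) (ball 0 1))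
    (hh0 : EqOn (deriv h) 0 (ball 0 1)) (hloc : LocallyUnivalentOn f (ball 0 1))
    (hS : ∀ z ∈ ball (0 : ℂ) 1, schwarzian f z = 0) : InjOn f (ball 0 1) := by
  have hU : IsOpen (ball (0 : ℂ) 1) := isOpen_ball
  have hUc : IsPreconnected (ball (0 : ℂ) 1) := (convex_ball 0 1).isPreconnected
  have hhan := hh.analyticOnNhd hU
  have hgan := hg.analyticOnNhd hU
  have hhc : ∀ z ∈ ball (0 : ℂ) 1, ∀ w ∈ ball (0 : ℂ) 1, h z = h w := fun z hz w hw =>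
    hU.is_const_of_deriv_eq_zero hUc hh hh0 hz hw
  have hg0 : ∀ c ∈ ball (0 : ℂ) 1, deriv g c ≠ 0 := by
    rcases eqOn_zero_or_forall_eventually_ne hgan.deriv hUc with h0 | h0
    · exfalso
      obtain ⟨V, hV, hVU, hinj⟩ := hloc.exists_mem_nhds hU (mem_ball_self one_pos)
      have hne : ∀ᶠ z in 𝓝[≠] (0 : ℂ), z ∈ V := nhdsWithin_le_nhds hV
      obtain ⟨z, hzV, hz0⟩ := (hne.and self_mem_nhdsWithin).exists
      refine hz0 (hinj hzV (mem_of_mem_nhds hV) ?_)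
      have hz := hVU hzV
      have h00 : (0 : ℂ) ∈ ball (0 : ℂ) 1 := mem_ball_self one_pos
      rw [hf hz, hf h00]
      simp only [hhc z hz 0 h00, hU.is_const_of_deriv_eq_zero hUc hg h0 hz h00]
    · intro c hc
      obtain ⟨V, hV, hVU, hinj⟩ := hloc.exists_mem_nhds hU hc
      -- Applied to `conj f = g + conj h`, with the roles of `h` and `g` exchanged.
      refine deriv_ne_zero_of_injOn (hgan c hc) (hhan c hc) ?_ hV fun z hz w hw hzw =>
        hinj hz hw ?_
      · filter_upwards [h0 c hc, nhdsWithin_le_nhds (hU.mem_nhds hc)] with z hz hzU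
        rw [hh0 hzU]
        simpa using hz
      · rw [hf (hVU hz), hf (hVU hw)]
        have := congrArg conj hzw
        simp only [map_add, Complex.conj_conj] at this
        linear_combination this
  have hJ : ∀ z ∈ ball (0 : ℂ) 1, jacobian f z ≠ 0 := by
    intro z hz
    have hw := hasWirtingerAt_add_conj hU hh hg hf hz
    rw [jacobian, hw.dz_eq, hw.dzbar_eq, hh0 hz]
    simpa using hg0 z hz
  have hinj : InjOn g (ball 0 1) := by
    refine injOn_of_norm_schwarzian_le hg hg0 fun z hz => ?_
    have h1 := hS z hz
    have hc : conj (deriv g z) ≠ 0 := (map_ne_zero _).2 (hg0 z hz)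
    -- Here the Jacobian is `-|g'|²`. As `Real.log` is the logarithm of the absolute value, `S_f` is
    -- still defined, and it equals the Schwarzian of `g`.
    rw [schwarzian_eq hU hh hg hf hJ hz, preSchwarzian_eq hU hh hg hf hz (hJ z hz), hh0 hz] at h1
    simp only [Pi.zero_apply, map_zero, mul_zero, zero_sub, neg_div_neg_eq,
      mul_div_mul_right _ _ hc] at h1
    rw [h1]
    norm_num
  intro z hz w hw hzw
  rw [hf hz, hf hw] at hzw
  simp only [hhc z hz w hw] at hzw
  exact hinj hz hw ((starRingEnd ℂ).injective (add_left_cancel hzw))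

end PlanarHarmonic

open PlanarHarmonic

/-! ### The univalence criterion. -/

theorem theorem2 (f : ℂ → ℂ)
    (hharm : InnerProductSpace.HarmonicOnNhd f (Metric.ball (0 : ℂ) 1))
    (hloc : PlanarHarmonic.LocallyUnivalentOn f (Metric.ball (0 : ℂ) 1))
    (hdil : Set.MapsTo (PlanarHarmonic.dilatation f) (Metric.ball (0 : ℂ) 1)
      (Metric.ball (0 : ℂ) 1))
    (hineq : ∀ z ∈ Metric.ball (0 : ℂ) 1,
      (1 - ‖z‖ ^ 2) ^ 2 * ‖PlanarHarmonic.schwarzian f z‖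
        + 2 * ‖PlanarHarmonic.hyperbolicDeriv (PlanarHarmonic.dilatation f) z
            * PlanarHarmonic.harmonicOrder f z‖
        ≤ (1 / 2) * ‖PlanarHarmonic.hyperbolicDeriv (PlanarHarmonic.dilatation f) z‖ ^ 2) :
    Set.InjOn f (Metric.ball (0 : ℂ) 1) := by
  obtain ⟨h, g, hh, hg, hf⟩ := exists_eqOn_add_conj hharm
  have hU : IsOpen (ball (0 : ℂ) 1) := isOpen_ball
  have hhan := hh.analyticOnNhd hU
  have hgan := hg.analyticOnNhd hU
  have hω : ∀ z ∈ ball (0 : ℂ) 1, dilatation f z = deriv g z / deriv h z := fun z hz =>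
    dilatation_eq hU hh hg hf hz
  -- Division by zero gives the dilatation the value `0` where `h' = 0`, so `hdil` carries no
  -- information at such points.
  have hltne : ∀ z ∈ ball (0 : ℂ) 1, deriv h z ≠ 0 → ‖deriv g z‖ < ‖deriv h z‖ := by
    intro z hz hne
    have := hdil hz
    rwa [hω z hz, mem_ball_zero_iff, norm_div, div_lt_one (norm_pos_iff.2 hne)] at this
  rcases eqOn_zero_or_forall_eventually_ne hhan.deriv (convex_ball 0 1).isPreconnected
    with h0 | h0
  -- When `h'` vanishes identically the dilatation is identically `0`, so the right side of `hineq`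
  -- is `0` and `S_f` vanishes.
  · refine injOn_of_antiholomorphic hh hg hf h0 hloc fun z hz => ?_
    have hωz : dilatation f =ᶠ[𝓝 z] fun _ => 0 := by
      filter_upwards [hU.mem_nhds hz] with w hw
      rw [hω w hw, h0 hw, Pi.zero_apply, div_zero]
    have h1 := hineq z hz
    rw [hyperbolicDeriv, hωz.deriv_eq, deriv_const, mul_zero, zero_div, zero_mul, norm_zero,
      mul_zero, add_zero, zero_pow two_ne_zero, mul_zero] at h1
    have h2 : 0 < (1 - ‖z‖ ^ 2) ^ 2 := pow_pos (one_sub_normSq_pos hz) 2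
    exact norm_le_zero_iff.1 (nonpos_of_mul_nonpos_right h1 h2)
  · refine injOn_of_sensePreserving hh hg hf (fun c hc => hltne c hc ?_) hineq
    obtain ⟨V, hV, hVU, hinj⟩ := hloc.exists_mem_nhds hU hc
    refine deriv_ne_zero_of_injOn (hhan c hc) (hgan c hc) ?_ hV fun z hz w hw hzw =>
      hinj hz hw ?_
    · filter_upwards [h0 c hc, nhdsWithin_le_nhds (hU.mem_nhds hc)] with z hz hzU
        using hltne z hzU hz
    · rw [hf (hVU hz), hf (hVU hw)]
      exact hzw
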